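/- Let $d\ge 1$ and let $\Omega$ be either $\mathbb R^d$ or $\mathbb R^d\setminus\{0\}$. Let $\mathcal E_M(\Omega)$ be the algebra of nets $(u_\varepsilon)_{\varepsilon\in(0,1]}$ of smooth complex-valued functions on $\Omega$ such that for every compact $K\subset\Omega$ and every multi-index $\beta\in\mathbb N_0^d$ there is $N\ge 0$ with $\sup_{x\in K}|\partial^\beta u_\varepsilon(x)|=O(\varepsilon^{-N})$ as $\varepsilon\to 0$. Let $\mathcal N(\Omega)$ be the ideal of those nets such that for every such $K$ and $\beta$ and every $m\ge 0$, $\sup_{x\in K}|\partial^\beta u_\varepsilon(x)|=O(\varepsilon^{m})$ as $\varepsilon\to 0$. Let $\mathcal G(\Omega)=\mathcal E_M(\Omega)/\mathcal N(\Omega)$ be the special Colombeau algebra, on which algebraic operations, partial derivatives and the dilations $u\mapsto u(\lambda\,\cdot\,)$ ($\lambda>0$) are defined componentwise on representatives. Let $u\in\mathcal G(\Omega)$ and $\alpha\in\mathbb R$. Then the following are equivalent: 1. $u$ satisfies the Euler equation $\sum_{i=1}^d x_i\,\frac{\partial u}{\partial x_i}=\alpha u$ in $\mathcal G(\Omega)$;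 2. $u$ is homogeneous of degree $\alpha$, that is, for each real $\lambda>0$ the equality $u(\lambda x)=\lambda^\alpha u(x)$ holds in $\mathcal G(\Omega)$. -/

import Mathlib

open TopologicalSpace
open scoped ContDiff

noncomputable section

namespace Colombeau

/-- The Euclidean space `ℝ^d`. -/
abbrev Space (d : ℕ) := EuclideanSpace ℝ (Fin d)

/-- The index set `(0,1]` of the regularisation parameter `ε`. -/
abbrev Param := Set.Ioc (0 : ℝ) 1

/-- Nets `(u_ε)_{ε ∈ (0,1]}` of complex-valued functions. A function on an open set `Ω` is written
as a function on all of `ℝ^d`; its values outside `Ω` are never looked at, and are divided out in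
the algebra below. -/
abbrev Net (d : ℕ) := Param → Space d → ℂ

variable {d : ℕ}

/-- The partial derivative `∂f/∂x_i`. -/
def partialDeriv (i : Fin d) (f : Space d → ℂ) : Space d → ℂ :=
  fun x => fderiv ℝ f x (EuclideanSpace.single i 1)

/-- The iterated partial derivative `∂_{i_k} ⋯ ∂_{i_1} f` along a finite sequence of coordinate
directions. For smooth `f` the order of the directions is irrelevant, so that these are exactly the
derivatives `∂^β f` with `β` a multi-index. -/
def iterPartial : List (Fin d) → (Space d → ℂ) → (Space d → ℂ)
  | [], f => f
  | i :: w, f => iterPartial w (partialDeriv i f)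

/-- `sup_{x ∈ K} |u_ε(x)| = O(ε^r)` as `ε → 0`. -/
def IsBigOOn (K : Set (Space d)) (u : Net d) (r : ℤ) : Prop :=
  ∃ C : ℝ, ∃ η : ℝ, 0 < η ∧ ∀ ε : Param, (ε : ℝ) < η → ∀ x ∈ K, ‖u ε x‖ ≤ C * (ε : ℝ) ^ r

/-- Every `u_ε` is of class `C^∞` on `Ω`. -/
def IsSmoothNet (Ω : Opens (Space d)) (u : Net d) : Prop :=
  ∀ ε : Param, ContDiffOn ℝ ∞ (u ε) Ω

/-- Membership in `E_M(Ω)`. -/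
def IsModerate (Ω : Opens (Space d)) (u : Net d) : Prop :=
  IsSmoothNet Ω u ∧ ∀ K : Set (Space d), IsCompact K → K ⊆ Ω → ∀ w : List (Fin d),
    ∃ N : ℕ, IsBigOOn K (fun ε => iterPartial w (u ε)) (-(N : ℤ))

/-- Membership in `N(Ω)`. -/
def IsNegligible (Ω : Opens (Space d)) (u : Net d) : Prop :=
  IsSmoothNet Ω u ∧ ∀ K : Set (Space d), IsCompact K → K ⊆ Ω → ∀ w : List (Fin d),
    ∀ m : ℕ, IsBigOOn K (fun ε => iterPartial w (u ε)) (m : ℤ)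

/-! ### Elementary facts about derivatives -/

section Derivatives

variable {Ω : Opens (Space d)}

theorem contDiffOn_partialDeriv {f : Space d → ℂ} (hf : ContDiffOn ℝ ∞ f Ω) (i : Fin d) :
    ContDiffOn ℝ ∞ (partialDeriv i f) Ω :=
  (hf.fderiv_of_isOpen Ω.isOpen (by simp)).clm_apply contDiffOn_const

theorem differentiableAt_of_smooth {f : Space d → ℂ} (hf : ContDiffOn ℝ ∞ f Ω) {x : Space d}
    (hx : x ∈ Ω) : DifferentiableAt ℝ f x :=
  (hf.contDiffAt (Ω.isOpen.mem_nhds hx)).differentiableAt (by simp)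

theorem partialDeriv_congr {f g : Space d → ℂ} (h : Set.EqOn f g Ω) (i : Fin d) :
    Set.EqOn (partialDeriv i f) (partialDeriv i g) Ω := by
  intro x hx
  have : f =ᶠ[nhds x] g := Filter.eventuallyEq_of_mem (Ω.isOpen.mem_nhds hx) h
  simp only [partialDeriv, this.fderiv_eq]

theorem iterPartial_congr (w : List (Fin d)) : ∀ {f g : Space d → ℂ}, Set.EqOn f g Ω →
    Set.EqOn (iterPartial w f) (iterPartial w g) Ω := by
  induction w with
  | nil => intro f g h; exact h
  | cons i w ih => intro f g h; exact ih (partialDeriv_congr h i)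

theorem iterPartial_add (w : List (Fin d)) : ∀ {f g : Space d → ℂ}, ContDiffOn ℝ ∞ f Ω →
    ContDiffOn ℝ ∞ g Ω →
    Set.EqOn (iterPartial w (f + g)) (iterPartial w f + iterPartial w g) Ω := by
  induction w with
  | nil => intro f g _ _ x _; rfl
  | cons i w ih =>
    intro f g hf hg
    have h : Set.EqOn (partialDeriv i (f + g)) (partialDeriv i f + partialDeriv i g) Ω := by
      intro x hx
      simp only [partialDeriv, Pi.add_apply]
      rw [fderiv_add (differentiableAt_of_smooth hf hx) (differentiableAt_of_smooth hg hx)]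
      rfl
    exact (iterPartial_congr w h).trans
      (ih (contDiffOn_partialDeriv hf i) (contDiffOn_partialDeriv hg i))

theorem partialDeriv_mul {f g : Space d → ℂ} (hf : ContDiffOn ℝ ∞ f Ω)
    (hg : ContDiffOn ℝ ∞ g Ω) (i : Fin d) :
    Set.EqOn (partialDeriv i (f * g)) (partialDeriv i f * g + f * partialDeriv i g) Ω := by
  intro x hx
  simp only [partialDeriv, Pi.add_apply, Pi.mul_apply]
  rw [fderiv_mul (differentiableAt_of_smooth hf hx) (differentiableAt_of_smooth hg hx)]
  simp
  ring

theorem iterPartial_mul_cons (i : Fin d) (w : List (Fin d)) {f g : Space d → ℂ}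
    (hf : ContDiffOn ℝ ∞ f Ω) (hg : ContDiffOn ℝ ∞ g Ω) :
    Set.EqOn (iterPartial (i :: w) (f * g))
      (iterPartial w (partialDeriv i f * g) + iterPartial w (f * partialDeriv i g)) Ω :=
  (iterPartial_congr w (partialDeriv_mul hf hg i)).trans
    (iterPartial_add w ((contDiffOn_partialDeriv hf i).mul hg)
      (hf.mul (contDiffOn_partialDeriv hg i)))

theorem iterPartial_smul (w : List (Fin d)) (c : ℂ) : ∀ (f : Space d → ℂ),
    iterPartial w (c • f) = c • iterPartial w f := by
  induction w with
  | nil => intro f; rfl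
  | cons i w ih =>
    intro f
    have h : partialDeriv i (c • f) = c • partialDeriv i f := by
      funext x
      simp only [partialDeriv, fderiv_const_smul_field, Pi.smul_apply]
      rfl
    simp only [iterPartial, h, ih]

theorem iterPartial_zero (w : List (Fin d)) : iterPartial w (0 : Space d → ℂ) = 0 := by
  have := iterPartial_smul w 0 (0 : Space d → ℂ)
  simpa using this

theorem partialDeriv_const (i : Fin d) (c : ℂ) : partialDeriv i (fun _ => c) = 0 := by
  funext x
  simp [partialDeriv]

theorem iterPartial_dilate (w : List (Fin d)) (r : ℝ) : ∀ (f : Space d → ℂ),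
    iterPartial w (fun x => f (r • x)) =
      ((r : ℂ) ^ w.length) • fun x => iterPartial w f (r • x) := by
  induction w with
  | nil => intro f; funext x; simp [iterPartial]
  | cons i w ih =>
    intro f
    have h : partialDeriv i (fun x => f (r • x)) =
        (r : ℂ) • fun x => partialDeriv i f (r • x) := by
      funext x
      simp only [partialDeriv, Pi.smul_apply]
      rw [fderiv_comp_smul]
      simp
    simp only [iterPartial, h, iterPartial_smul, ih, smul_smul, List.length_cons, pow_succ']

end Derivatives

/-! ### Elementary facts about the growth conditions -/

section Growth

variable {Ω : Opens (Space d)} {K : Set (Space d)} {u v : Net d}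

theorem IsBigOOn.congr {r : ℤ} (h : ∀ ε, Set.EqOn (u ε) (v ε) K) (hu : IsBigOOn K u r) :
    IsBigOOn K v r := by
  obtain ⟨C, η, hη, H⟩ := hu
  exact ⟨C, η, hη, fun ε hε x hx => h ε hx ▸ H ε hε x hx⟩

theorem IsBigOOn.mono {r s : ℤ} (hrs : s ≤ r) (hu : IsBigOOn K u r) : IsBigOOn K u s := by
  obtain ⟨C, η, hη, H⟩ := hu
  refine ⟨|C|, η, hη, fun ε hε x hx => (H ε hε x hx).trans ?_⟩
  have h1 : (ε : ℝ) ^ r ≤ (ε : ℝ) ^ s := zpow_le_zpow_right_of_le_one₀ ε.2.1 ε.2.2 hrs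
  have h2 : (0 : ℝ) ≤ (ε : ℝ) ^ r := zpow_nonneg ε.2.1.le r
  calc C * (ε : ℝ) ^ r ≤ |C| * (ε : ℝ) ^ r := mul_le_mul_of_nonneg_right (le_abs_self C) h2
    _ ≤ |C| * (ε : ℝ) ^ s := mul_le_mul_of_nonneg_left h1 (abs_nonneg C)

theorem IsBigOOn.add {r : ℤ} (hu : IsBigOOn K u r) (hv : IsBigOOn K v r) :
    IsBigOOn K (u + v) r := by
  obtain ⟨C, η, hη, H⟩ := hu
  obtain ⟨C', η', hη', H'⟩ := hv
  refine ⟨C + C', min η η', lt_min hη hη', fun ε hε x hx => ?_⟩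
  rw [add_mul]
  exact (norm_add_le _ _).trans (add_le_add (H ε (hε.trans_le (min_le_left _ _)) x hx)
    (H' ε (hε.trans_le (min_le_right _ _)) x hx))

theorem IsBigOOn.mul {r s : ℤ} (hu : IsBigOOn K u r) (hv : IsBigOOn K v s) :
    IsBigOOn K (u * v) (r + s) := by
  obtain ⟨C, η, hη, H⟩ := hu
  obtain ⟨C', η', hη', H'⟩ := hv
  refine ⟨C * C', min η η', lt_min hη hη', fun ε hε x hx => ?_⟩
  have h1 := H ε (hε.trans_le (min_le_left _ _)) x hx
  have h2 := H' ε (hε.trans_le (min_le_right _ _)) x hx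
  calc ‖(u * v) ε x‖ = ‖u ε x‖ * ‖v ε x‖ := norm_mul _ _
    _ ≤ (C * (ε : ℝ) ^ r) * (C' * (ε : ℝ) ^ s) :=
      mul_le_mul h1 h2 (norm_nonneg _) ((norm_nonneg _).trans h1)
    _ = C * C' * (ε : ℝ) ^ (r + s) := by rw [zpow_add₀ ε.2.1.ne']; ring

theorem IsBigOOn.smul {r : ℤ} (c : ℂ) (hu : IsBigOOn K u r) : IsBigOOn K (c • u) r := by
  obtain ⟨C, η, hη, H⟩ := hu
  refine ⟨‖c‖ * C, η, hη, fun ε hε x hx => ?_⟩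
  calc ‖(c • u) ε x‖ = ‖c‖ * ‖u ε x‖ := norm_mul _ _
    _ ≤ ‖c‖ * (C * (ε : ℝ) ^ r) := mul_le_mul_of_nonneg_left (H ε hε x hx) (norm_nonneg c)
    _ = ‖c‖ * C * (ε : ℝ) ^ r := by ring

theorem isBigOOn_zero (r : ℤ) : IsBigOOn K (0 : Net d) r :=
  ⟨0, 1, one_pos, fun ε _ x _ => by simp⟩

theorem IsNegligible.isModerate (hu : IsNegligible Ω u) : IsModerate Ω u :=
  ⟨hu.1, fun K hK hKΩ w => ⟨0, by simpa using hu.2 K hK hKΩ w 0⟩⟩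

theorem IsModerate.partialDeriv (hu : IsModerate Ω u) (i : Fin d) :
    IsModerate Ω (fun ε => partialDeriv i (u ε)) :=
  ⟨fun ε => contDiffOn_partialDeriv (hu.1 ε) i, fun K hK hKΩ w => hu.2 K hK hKΩ (i :: w)⟩

theorem IsNegligible.partialDeriv (hu : IsNegligible Ω u) (i : Fin d) :
    IsNegligible Ω (fun ε => partialDeriv i (u ε)) :=
  ⟨fun ε => contDiffOn_partialDeriv (hu.1 ε) i, fun K hK hKΩ w => hu.2 K hK hKΩ (i :: w)⟩

theorem IsModerate.add (hu : IsModerate Ω u) (hv : IsModerate Ω v) : IsModerate Ω (u + v) := by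
  refine ⟨fun ε => (hu.1 ε).add (hv.1 ε), fun K hK hKΩ w => ?_⟩
  obtain ⟨N, hN⟩ := hu.2 K hK hKΩ w
  obtain ⟨N', hN'⟩ := hv.2 K hK hKΩ w
  refine ⟨max N N', IsBigOOn.congr (fun ε => ?_)
    ((hN.mono (s := -((max N N' : ℕ) : ℤ)) (by push_cast; omega)).add
      (hN'.mono (s := -((max N N' : ℕ) : ℤ)) (by push_cast; omega)))⟩
  exact ((iterPartial_add w (hu.1 ε) (hv.1 ε)).mono hKΩ).symm

theorem IsNegligible.add (hu : IsNegligible Ω u) (hv : IsNegligible Ω v) :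
    IsNegligible Ω (u + v) := by
  refine ⟨fun ε => (hu.1 ε).add (hv.1 ε), fun K hK hKΩ w m => ?_⟩
  exact IsBigOOn.congr (fun ε => ((iterPartial_add w (hu.1 ε) (hv.1 ε)).mono hKΩ).symm)
    ((hu.2 K hK hKΩ w m).add (hv.2 K hK hKΩ w m))

theorem IsModerate.mul (hu : IsModerate Ω u) (hv : IsModerate Ω v) : IsModerate Ω (u * v) := by
  refine ⟨fun ε => (hu.1 ε).mul (hv.1 ε), fun K hK hKΩ w => ?_⟩
  induction w generalizing u v with
  | nil =>
    obtain ⟨N, hN⟩ := hu.2 K hK hKΩ []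
    obtain ⟨N', hN'⟩ := hv.2 K hK hKΩ []
    exact ⟨N + N', (hN.mul hN').mono (by push_cast; omega)⟩
  | cons i w ih =>
    obtain ⟨N, hN⟩ := ih (hu.partialDeriv i) hv
    obtain ⟨N', hN'⟩ := ih hu (hv.partialDeriv i)
    refine ⟨max N N', IsBigOOn.congr (fun ε => ?_)
      ((hN.mono (s := -((max N N' : ℕ) : ℤ)) (by push_cast; omega)).add
        (hN'.mono (s := -((max N N' : ℕ) : ℤ)) (by push_cast; omega)))⟩
    exact ((iterPartial_mul_cons i w (hu.1 ε) (hv.1 ε)).mono hKΩ).symm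

theorem IsModerate.mul_isNegligible (hu : IsModerate Ω u) (hv : IsNegligible Ω v) :
    IsNegligible Ω (u * v) := by
  refine ⟨fun ε => (hu.1 ε).mul (hv.1 ε), fun K hK hKΩ w => ?_⟩
  induction w generalizing u v with
  | nil =>
    intro m
    obtain ⟨N, hN⟩ := hu.2 K hK hKΩ []
    exact (hN.mul (hv.2 K hK hKΩ [] (m + N))).mono (by push_cast; omega)
  | cons i w ih =>
    intro m
    exact IsBigOOn.congr
      (fun ε => ((iterPartial_mul_cons i w (hu.1 ε) (hv.1 ε)).mono hKΩ).symm)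
      ((ih (hu.partialDeriv i) hv m).add (ih hu (hv.partialDeriv i) m))

theorem isNegligible_zero : IsNegligible Ω (0 : Net d) :=
  ⟨fun _ => contDiffOn_const, fun _ _ _ w m =>
    (isBigOOn_zero (m : ℤ)).congr fun ε x _ => by
      change (0 : ℂ) = iterPartial w (0 : Space d → ℂ) x
      rw [iterPartial_zero]; rfl⟩

/-- A fixed smooth function, as a constant net, is moderate. -/
theorem isModerate_of_smooth {f : Space d → ℂ} (hf : ContDiffOn ℝ ∞ f Ω) :
    IsModerate Ω (fun _ => f) := by
  refine ⟨fun _ => hf, fun K hK hKΩ w => ⟨0, ?_⟩⟩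
  have hc : ContDiffOn ℝ ∞ (iterPartial w f) Ω := by
    induction w generalizing f with
    | nil => exact hf
    | cons i w ih => exact ih (contDiffOn_partialDeriv hf i)
  obtain ⟨C, hC⟩ := hK.exists_bound_of_continuousOn (hc.continuousOn.mono hKΩ)
  exact ⟨C, 1, one_pos, fun ε _ x hx => by simpa using hC x hx⟩

theorem isModerate_dilate {r : ℝ} (hr : ∀ x ∈ Ω, r • x ∈ Ω) (hu : IsModerate Ω u) :
    IsModerate Ω (fun ε x => u ε (r • x)) := by
  refine ⟨fun ε => (hu.1 ε).comp (contDiff_const_smul r).contDiffOn hr, fun K hK hKΩ w => ?_⟩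
  obtain ⟨N, C, η, hη, H⟩ := hu.2 ((fun x => r • x) '' K) (hK.image (continuous_const_smul r))
    (by rintro _ ⟨x, hx, rfl⟩; exact hr x (hKΩ hx)) w
  refine ⟨N, IsBigOOn.congr (fun ε x _ => ?_)
    (IsBigOOn.smul ((r : ℂ) ^ w.length)
      (u := fun ε x => iterPartial w (u ε) (r • x))
      ⟨C, η, hη, fun ε hε x hx => H ε hε _ ⟨x, hx, rfl⟩⟩)⟩
  simp only [iterPartial_dilate]
  rfl

theorem isNegligible_dilate {r : ℝ} (hr : ∀ x ∈ Ω, r • x ∈ Ω) (hu : IsNegligible Ω u) :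
    IsNegligible Ω (fun ε x => u ε (r • x)) := by
  refine ⟨fun ε => (hu.1 ε).comp (contDiff_const_smul r).contDiffOn hr,
    fun K hK hKΩ w m => ?_⟩
  obtain ⟨C, η, hη, H⟩ := hu.2 ((fun x => r • x) '' K) (hK.image (continuous_const_smul r))
    (by rintro _ ⟨x, hx, rfl⟩; exact hr x (hKΩ hx)) w m
  refine IsBigOOn.congr (fun ε x _ => ?_)
    (IsBigOOn.smul ((r : ℂ) ^ w.length)
      (u := fun ε x => iterPartial w (u ε) (r • x))
      ⟨C, η, hη, fun ε hε x hx => H ε hε _ ⟨x, hx, rfl⟩⟩)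
  simp only [iterPartial_dilate]
  rfl

end Growth

/-! ### The special Colombeau algebra -/

/-- The algebra `E_M(Ω)` of moderate nets, with componentwise operations. -/
def Moderate (Ω : Opens (Space d)) : Subalgebra ℂ (Net d) where
  carrier := {u | IsModerate Ω u}
  add_mem' hu hv := IsModerate.add hu hv
  mul_mem' hu hv := IsModerate.mul hu hv
  algebraMap_mem' c := isModerate_of_smooth (f := fun _ => c) contDiffOn_const

/-- The ideal `N(Ω)` of negligible nets in `E_M(Ω)`. -/
def Negligible (Ω : Opens (Space d)) : Ideal (Moderate Ω) where
  carrier := {u | IsNegligible Ω (u : Net d)}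
  add_mem' hu hv := IsNegligible.add hu hv
  zero_mem' := isNegligible_zero
  smul_mem' u _ hv := IsModerate.mul_isNegligible u.2 hv

/-- The special Colombeau algebra `G(Ω) = E_M(Ω) / N(Ω)`. -/
abbrev GenFun (Ω : Opens (Space d)) : Type := Moderate Ω ⧸ Negligible Ω

/-- The class in `G(Ω)` of a moderate net. -/
def mk {Ω : Opens (Space d)} (u : Net d) (hu : IsModerate Ω u) : GenFun Ω :=
  Ideal.Quotient.mk (Negligible Ω) ⟨u, hu⟩

theorem mk_eq_mk {Ω : Opens (Space d)} {u v : Net d} (hu : IsModerate Ω u)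
    (hv : IsModerate Ω v) : mk u hu = mk v hv ↔ IsNegligible Ω (u - v) :=
  Ideal.Quotient.mk_eq_mk_iff_sub_mem _ _

variable {Ω : Opens (Space d)}

/-- The coordinate function `x_i` as an element of `G(Ω)`. -/
def coord (i : Fin d) : GenFun Ω :=
  mk (fun _ x => ((x i : ℝ) : ℂ))
    (isModerate_of_smooth (Complex.ofRealCLM.contDiff.comp
      (EuclideanSpace.proj (𝕜 := ℝ) i).contDiff).contDiffOn)

/-- The partial derivative `∂u/∂x_i` of `u ∈ G(Ω)`, componentwise on representatives. -/
def pderiv (i : Fin d) (u : GenFun Ω) : GenFun Ω :=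
  Quotient.liftOn' u (fun v => mk (fun ε => partialDeriv i ((v : Net d) ε)) (v.2.partialDeriv i))
    (fun v w h => by
      have h' : IsNegligible Ω ((v : Net d) - (w : Net d)) := (Submodule.quotientRel_def _).1 h
      refine (mk_eq_mk _ _).2 ?_
      have hn := h'.partialDeriv i
      refine ⟨fun ε => (contDiffOn_partialDeriv (v.2.1 ε) i).sub
        (contDiffOn_partialDeriv (w.2.1 ε) i), fun K hK hKΩ l m =>
          (hn.2 K hK hKΩ l m).congr fun ε => (iterPartial_congr l ?_).mono hKΩ⟩
      intro x hx
      simp only [partialDeriv, Pi.sub_apply]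
      rw [fderiv_sub (differentiableAt_of_smooth (v.2.1 ε) hx)
        (differentiableAt_of_smooth (w.2.1 ε) hx)]
      rfl)

theorem pderiv_mk (i : Fin d) {u : Net d} (hu : IsModerate Ω u) :
    pderiv i (mk u hu) = mk (fun ε => partialDeriv i (u ε)) (hu.partialDeriv i) := rfl

/-- `Ω` is stable under the dilations `x ↦ λx`, `λ > 0`. -/
def IsConic (Ω : Opens (Space d)) : Prop :=
  ∀ r : ℝ, 0 < r → ∀ x ∈ Ω, r • x ∈ Ω

/-- The dilated generalized function `x ↦ u(λx)`, componentwise on representatives. -/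
def dilate (hΩ : IsConic Ω) (r : ℝ) (hr : 0 < r) (u : GenFun Ω) : GenFun Ω :=
  Quotient.liftOn' u
    (fun v => mk (fun ε x => (v : Net d) ε (r • x)) (isModerate_dilate (hΩ r hr) v.2))
    (fun v w h => by
      have h' : IsNegligible Ω ((v : Net d) - (w : Net d)) := (Submodule.quotientRel_def _).1 h
      exact (mk_eq_mk _ _).2 (isNegligible_dilate (hΩ r hr) h'))

theorem dilate_mk (hΩ : IsConic Ω) (r : ℝ) (hr : 0 < r) {u : Net d} (hu : IsModerate Ω u) :
    dilate hΩ r hr (mk u hu) =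
      mk (fun ε x => u ε (r • x)) (isModerate_dilate (hΩ r hr) hu) := rfl

/-- `u` satisfies the Euler equation `∑ x_i ∂u/∂x_i = α u` in `G(Ω)`. -/
def SatisfiesEuler (α : ℝ) (u : GenFun Ω) : Prop :=
  ∑ i : Fin d, coord i * pderiv i u = (α : ℂ) • u

/-- `u` is homogeneous of degree `α`: for each real `λ > 0`, `u(λx) = λ^α u(x)` in `G(Ω)`. -/
def IsHomogeneous (hΩ : IsConic Ω) (α : ℝ) (u : GenFun Ω) : Prop :=
  ∀ (r : ℝ) (hr : 0 < r), dilate hΩ r hr u = ((r ^ α : ℝ) : ℂ) • u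

/-- The open set `ℝ^d`. -/
def whole (d : ℕ) : Opens (Space d) := ⊤

/-- The open set `ℝ^d ∖ {0}`. -/
def punctured (d : ℕ) : Opens (Space d) := ⟨{0}ᶜ, isOpen_compl_singleton⟩

theorem isConic_whole (d : ℕ) : IsConic (whole d) := fun _ _ _ _ => trivial

theorem isConic_punctured (d : ℕ) : IsConic (punctured d) := fun _ hr _ hx =>
  smul_ne_zero hr.ne' hx

end Colombeau

end

/-! Write `E` for `eulerOp α`. Along the ray through `x` the function `G(s) = e^(-αs) u(e^s x)` has
derivative `e^(-αs) (E u)(e^s x)` (`hasDerivAt_exp_mul_dilate`), and homogeneity says that `G(s) -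
G(0)` is negligible for each fixed `s`. If `E u` is negligible, the mean value inequality bounds
`G(s) - G(0)` on compact sets (`isBigOOn_dilateDefect`). Conversely, homogeneity controls `G(s) -
G(0)` for each `s` separately, with constants depending on `s`. Baire's theorem makes the bound
uniform on some interval starting at `a` (`exists_uniform_isBigOOn`). As `E (E u)` is moderate, so
is `G''`, and a Landau inequality (`mul_norm_deriv_le`) makes `G'(a)` small. This controls `E u` at
`e^a x`; since `E` commutes with the homogeneity defect, the bound moves back to `x`
(`isBigOOn_eulerOp`). Higher derivatives follow by induction: a partial derivative of `u` satisfies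
the same conditions with degree `α - 1`. -/

namespace Colombeau

variable {d : ℕ} {Ω : Opens (Space d)}

/-! ### Euler operator, homogeneity defect and their commutation rules -/

/-- The operator `f ↦ ∑ x_i ∂f/∂x_i - α f`. -/
noncomputable def eulerOp (α : ℝ) (f : Space d → ℂ) : Space d → ℂ :=
  fun x => ∑ i, ((x i : ℝ) : ℂ) * partialDeriv i f x - (α : ℂ) * f x

/-- The defect `f(r x) - r ^ α f(x)` of homogeneity. -/
noncomputable def dilateDefect (α r : ℝ) (f : Space d → ℂ) : Space d → ℂ :=
  fun x => f (r • x) - ((r ^ α : ℝ) : ℂ) * f x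

theorem contDiff_coord (i : Fin d) : ContDiff ℝ ∞ (fun x : Space d => ((x i : ℝ) : ℂ)) :=
  Complex.ofRealCLM.contDiff.comp (EuclideanSpace.proj (𝕜 := ℝ) i).contDiff

theorem fderiv_apply_eq_sum_partialDeriv (f : Space d → ℂ) (x v : Space d) :
    fderiv ℝ f x v = ∑ i, ((v i : ℝ) : ℂ) * partialDeriv i f x := by
  have hv : v = ∑ i, v i • EuclideanSpace.single i (1 : ℝ) := by
    have h := (EuclideanSpace.basisFun (Fin d) ℝ).sum_repr v
    simpa using h.symm
  conv_lhs => rw [hv]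
  simp [partialDeriv, map_sum]

theorem eulerOp_apply (α : ℝ) (f : Space d → ℂ) (x : Space d) :
    eulerOp α f x = fderiv ℝ f x x - (α : ℂ) * f x := by
  rw [fderiv_apply_eq_sum_partialDeriv]; rfl

theorem contDiffOn_dilateDefect {f : Space d → ℂ} (hf : ContDiffOn ℝ ∞ f Ω) {r : ℝ}
    (hr : ∀ x ∈ Ω, r • x ∈ Ω) (α : ℝ) : ContDiffOn ℝ ∞ (dilateDefect α r f) Ω :=
  (hf.comp (contDiff_const_smul r).contDiffOn hr).sub (contDiffOn_const.mul hf)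

theorem partialDeriv_comm {f : Space d → ℂ} (hf : ContDiffOn ℝ ∞ f Ω) (i j : Fin d)
    {x : Space d} (hx : x ∈ Ω) :
    partialDeriv i (partialDeriv j f) x = partialDeriv j (partialDeriv i f) x := by
  have hc : ContDiffAt ℝ ∞ f x := hf.contDiffAt (Ω.isOpen.mem_nhds hx)
  have hd : DifferentiableAt ℝ (fderiv ℝ f) x :=
    (hc.fderiv_right (m := ∞) (by simp)).differentiableAt (by simp)
  have h : ∀ i j : Fin d, partialDeriv i (partialDeriv j f) x =
      fderiv ℝ (fderiv ℝ f) x (EuclideanSpace.single i 1) (EuclideanSpace.single j 1) := by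
    intro i j
    have : partialDeriv j f = fun y => fderiv ℝ f y (EuclideanSpace.single j 1) := rfl
    rw [partialDeriv, this, fderiv_clm_apply hd (differentiableAt_const _)]
    simp
  rw [h, h]
  exact (hc.isSymmSndFDerivAt (by
    rw [minSmoothness_of_isRCLikeNormedField]; exact ENat.LEInfty.out)).eq _ _

theorem partialDeriv_coord (i j : Fin d) (x : Space d) :
    partialDeriv j (fun x : Space d => ((x i : ℝ) : ℂ)) x = if i = j then 1 else 0 := by
  have h : HasFDerivAt (fun x : Space d => ((x i : ℝ) : ℂ))
      (Complex.ofRealCLM.comp (EuclideanSpace.proj (𝕜 := ℝ) i)) x :=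
    (Complex.ofRealCLM.comp (EuclideanSpace.proj (𝕜 := ℝ) i)).hasFDerivAt
  rw [partialDeriv, h.fderiv]
  by_cases hij : i = j <;> simp [hij]

/-- The shift of degree comes from the product rule: differentiating the factor `x_j` leaves one
extra `∂_j f`. -/
theorem partialDeriv_eulerOp {f : Space d → ℂ} (hf : ContDiffOn ℝ ∞ f Ω) (α : ℝ) (j : Fin d) :
    Set.EqOn (partialDeriv j (eulerOp α f)) (eulerOp (α - 1) (partialDeriv j f)) Ω := by
  intro x hx
  have hp : ∀ i, DifferentiableAt ℝ (partialDeriv i f) x := fun i =>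
    differentiableAt_of_smooth (contDiffOn_partialDeriv hf i) hx
  have hc : ∀ i, DifferentiableAt ℝ (fun x : Space d => ((x i : ℝ) : ℂ)) x := fun i =>
    (contDiff_coord i).differentiable (by simp) x
  have hcp : ∀ i, DifferentiableAt ℝ
      (fun y : Space d => ((y i : ℝ) : ℂ) * partialDeriv i f y) x := fun i => (hc i).mul (hp i)
  have hm : ∀ i, partialDeriv j (fun y => ((y i : ℝ) : ℂ) * partialDeriv i f y) x =
      (if i = j then partialDeriv i f x else 0) +
        ((x i : ℝ) : ℂ) * partialDeriv i (partialDeriv j f) x := by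
    intro i
    have := partialDeriv_mul (Ω := Ω) (contDiff_coord i).contDiffOn
      (contDiffOn_partialDeriv hf i) j hx
    simp only [Pi.add_apply, Pi.mul_apply, partialDeriv_coord] at this
    rw [partialDeriv_comm hf i j hx]
    refine Eq.trans this ?_
    split_ifs <;> simp
  have h1 : partialDeriv j (eulerOp α f) x =
      ∑ i, partialDeriv j (fun y => ((y i : ℝ) : ℂ) * partialDeriv i f y) x -
        (α : ℂ) * partialDeriv j f x := by
    change fderiv ℝ (fun y => ∑ i, ((y i : ℝ) : ℂ) * partialDeriv i f y - (α : ℂ) * f y) x _ = _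
    rw [fderiv_fun_sub (DifferentiableAt.fun_sum fun i _ => hcp i)
      ((differentiableAt_of_smooth hf hx).const_mul _),
      fderiv_fun_sum (fun i _ => hcp i),
      fderiv_const_mul (differentiableAt_of_smooth hf hx)]
    simp [partialDeriv]
  rw [h1, Finset.sum_congr rfl fun i _ => hm i, Finset.sum_add_distrib]
  simp only [eulerOp, Finset.sum_ite_eq', Finset.mem_univ, if_true]
  push_cast
  ring

/-- The chain rule gives a factor `r` on the dilated term, and `r * r ^ (α - 1) = r ^ α` lets it be
pulled out of the whole defect. -/
theorem partialDeriv_dilateDefect {f : Space d → ℂ} (hf : ContDiffOn ℝ ∞ f Ω) {r : ℝ}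
    (hr : 0 < r) (hrΩ : ∀ x ∈ Ω, r • x ∈ Ω) (α : ℝ) (j : Fin d) :
    Set.EqOn (partialDeriv j (dilateDefect α r f))
      ((r : ℂ) • dilateDefect (α - 1) r (partialDeriv j f)) Ω := by
  intro x hx
  have hd : DifferentiableAt ℝ (fun x => f (r • x)) x :=
    differentiableAt_of_smooth (Ω := Ω) (hf.comp (contDiff_const_smul r).contDiffOn hrΩ) hx
  have h : (r : ℂ) * ((r ^ (α - 1) : ℝ) : ℂ) = ((r ^ α : ℝ) : ℂ) := by
    rw [Real.rpow_sub_one hr.ne', ← Complex.ofReal_mul, mul_div_cancel₀ _ hr.ne']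
  simp only [partialDeriv, dilateDefect, Pi.smul_apply, smul_eq_mul, mul_sub, ← mul_assoc, h]
  unfold dilateDefect
  rw [fderiv_fun_sub hd ((differentiableAt_of_smooth hf hx).const_mul _), fderiv_comp_smul,
    fderiv_const_mul (differentiableAt_of_smooth hf hx)]
  simp

/-- Dilations commute with the radial derivative. This later carries an estimate on `E u` from `e^a
x` back to `x`. -/
theorem eulerOp_dilateDefect {f : Space d → ℂ} (hf : ContDiffOn ℝ ∞ f Ω) {r : ℝ}
    (hrΩ : ∀ x ∈ Ω, r • x ∈ Ω) (α : ℝ) :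
    Set.EqOn (eulerOp α (dilateDefect α r f)) (dilateDefect α r (eulerOp α f)) Ω := by
  intro x hx
  have hd : DifferentiableAt ℝ (fun x => f (r • x)) x :=
    differentiableAt_of_smooth (Ω := Ω) (hf.comp (contDiff_const_smul r).contDiffOn hrΩ) hx
  simp only [dilateDefect, eulerOp_apply]
  unfold dilateDefect
  rw [fderiv_fun_sub hd ((differentiableAt_of_smooth hf hx).const_mul _), fderiv_comp_smul,
    fderiv_const_mul (differentiableAt_of_smooth hf hx)]
  simp
  ring

theorem hasDerivAt_exp_mul_dilate {f : Space d → ℂ} (hf : ContDiffOn ℝ ∞ f Ω) (α : ℝ) (s : ℝ)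
    {x : Space d} (hx : Real.exp s • x ∈ Ω) :
    HasDerivAt (fun t : ℝ => ((Real.exp (-(α * t)) : ℝ) : ℂ) * f (Real.exp t • x))
      (((Real.exp (-(α * s)) : ℝ) : ℂ) * eulerOp α f (Real.exp s • x)) s := by
  have h1 : HasDerivAt (fun t : ℝ => Real.exp t • x) (Real.exp s • x) s :=
    (Real.hasDerivAt_exp s).smul_const x
  have h2 := (differentiableAt_of_smooth hf hx).hasFDerivAt.comp_hasDerivAt s h1
  have h3 : HasDerivAt (fun t : ℝ => Real.exp (-(α * t))) (Real.exp (-(α * s)) * (-(α * 1))) s :=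
    (((hasDerivAt_id s).const_mul α).neg).exp
  have h4 := h3.ofReal_comp.mul h2
  refine h4.congr_deriv ?_
  rw [eulerOp_apply]
  simp only [Function.comp]
  push_cast
  ring

/-! ### Stability of moderate and negligible nets -/

section Nets

variable {u v : Net d}

theorem IsNegligible.congr (h : ∀ ε, Set.EqOn (u ε) (v ε) Ω) (hu : IsNegligible Ω u) :
    IsNegligible Ω v :=
  ⟨fun ε => (hu.1 ε).congr (h ε).symm, fun K hK hKΩ w m =>
    (hu.2 K hK hKΩ w m).congr fun ε => (iterPartial_congr w (h ε)).mono hKΩ⟩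

theorem IsNegligible.smul (c : ℂ) (hu : IsNegligible Ω u) : IsNegligible Ω (c • u) := by
  refine ⟨fun ε => (hu.1 ε).const_smul c, fun K hK hKΩ w m => ?_⟩
  refine ((hu.2 K hK hKΩ w m).smul c).congr fun ε x _ => ?_
  change c * iterPartial w (u ε) x = iterPartial w (c • u ε) x
  rw [iterPartial_smul]; rfl

theorem isNegligible_of_smul {c : ℂ} (hc : c ≠ 0) (hu : IsNegligible Ω (c • u)) :
    IsNegligible Ω u := by
  simpa [smul_smul, inv_mul_cancel₀ hc] using hu.smul c⁻¹

theorem IsModerate.eulerOp (α : ℝ) (hu : IsModerate Ω u) :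
    IsModerate Ω (fun ε => eulerOp α (u ε)) := by
  have h1 : IsModerate Ω (∑ i : Fin d,
      (fun _ x => ((x i : ℝ) : ℂ) : Net d) * fun ε => Colombeau.partialDeriv i (u ε)) :=
    (Moderate Ω).sum_mem fun i _ =>
      IsModerate.mul (isModerate_of_smooth (contDiff_coord i).contDiffOn) (hu.partialDeriv i)
  have h2 : IsModerate Ω (-(α : ℂ) • u) := (Moderate Ω).smul_mem hu _
  convert h1.add h2 using 1
  funext ε x
  simp [Colombeau.eulerOp, Finset.sum_apply, sub_eq_add_neg]

theorem IsNegligible.eulerOp (α : ℝ) (hu : IsNegligible Ω u) :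
    IsNegligible Ω (fun ε => eulerOp α (u ε)) := by
  have h1 : IsNegligible Ω (∑ i : Fin d,
      (fun _ x => ((x i : ℝ) : ℂ) : Net d) * fun ε => Colombeau.partialDeriv i (u ε)) :=
    Finset.sum_induction _ (IsNegligible Ω) (fun _ _ => IsNegligible.add) isNegligible_zero
      fun i _ => (isModerate_of_smooth (contDiff_coord i).contDiffOn).mul_isNegligible
        (hu.partialDeriv i)
  convert h1.add (hu.smul (-(α : ℂ))) using 1
  funext ε x
  simp [Colombeau.eulerOp, Finset.sum_apply, sub_eq_add_neg]

theorem isNegligible_eulerOp_partialDeriv {α : ℝ} (hu : IsSmoothNet Ω u)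
    (h : IsNegligible Ω fun ε => eulerOp α (u ε)) (i : Fin d) :
    IsNegligible Ω fun ε => eulerOp (α - 1) (partialDeriv i (u ε)) :=
  (h.partialDeriv i).congr fun ε => partialDeriv_eulerOp (hu ε) α i

theorem isNegligible_dilateDefect_partialDeriv {α r : ℝ} (hr : 0 < r)
    (hrΩ : ∀ x ∈ Ω, r • x ∈ Ω) (hu : IsSmoothNet Ω u)
    (h : IsNegligible Ω fun ε => dilateDefect α r (u ε)) (i : Fin d) :
    IsNegligible Ω fun ε => dilateDefect (α - 1) r (partialDeriv i (u ε)) :=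
  isNegligible_of_smul (c := (r : ℂ)) (by exact_mod_cast hr.ne')
    ((h.partialDeriv i).congr fun ε => partialDeriv_dilateDefect (hu ε) hr hrΩ α i)

/-! ### From the Euler equation to homogeneity -/

/-- A compact set is moved by a compact set of dilations within a compact set. -/
theorem exists_isCompact_dilates (hΩ : IsConic Ω) {K : Set (Space d)} (hK : IsCompact K)
    (hKΩ : K ⊆ Ω) {S : Set ℝ} (hS : IsCompact S) : ∃ K' : Set (Space d), IsCompact K' ∧ K' ⊆ Ω ∧
      ∀ x ∈ K, ∀ s ∈ S, Real.exp s • x ∈ K' := by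
  refine ⟨(fun p : ℝ × Space d => Real.exp p.1 • p.2) '' (S ×ˢ K),
    (hS.prod hK).image (by fun_prop), ?_, fun x hx s hs => ⟨(s, x), ⟨hs, hx⟩, rfl⟩⟩
  rintro _ ⟨⟨s, x⟩, ⟨-, hx⟩, rfl⟩
  exact hΩ _ (Real.exp_pos s) x (hKΩ hx)

theorem norm_exp_mul_le {α s B : ℝ} (hs : |s| ≤ B) (z : ℂ) {A : ℝ} (hz : ‖z‖ ≤ A) :
    ‖((Real.exp (-(α * s)) : ℝ) : ℂ) * z‖ ≤ Real.exp (|α| * B) * A := by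
  rw [norm_mul, Complex.norm_real, Real.norm_of_nonneg (Real.exp_pos _).le]
  refine mul_le_mul (Real.exp_le_exp.2 ?_) hz (norm_nonneg _) (Real.exp_pos _).le
  calc -(α * s) ≤ |α * s| := neg_le_abs _
    _ = |α| * |s| := abs_mul _ _
    _ ≤ |α| * B := mul_le_mul_of_nonneg_left hs (abs_nonneg α)

/-- In the logarithmic variable the defect is `e^(αs) (G(s) - G(0))`, so for fixed `s` either
quantity is negligible exactly when the other is. -/
theorem dilateDefect_exp (α s : ℝ) (f : Space d → ℂ) (x : Space d) :
    dilateDefect α (Real.exp s) f x = ((Real.exp (α * s) : ℝ) : ℂ) *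
      (((Real.exp (-(α * s)) : ℝ) : ℂ) * f (Real.exp s • x) - f x) := by
  have h : ((Real.exp (α * s) : ℝ) : ℂ) * ((Real.exp (-(α * s)) : ℝ) : ℂ) = 1 := by
    rw [← Complex.ofReal_mul, ← Real.exp_add]; simp
  rw [mul_sub, ← mul_assoc, h, one_mul, dilateDefect, ← Real.exp_mul, mul_comm s α]

theorem isBigOOn_dilateDefect (hΩ : IsConic Ω) {α : ℝ} (hu : IsSmoothNet Ω u)
    (h : IsNegligible Ω fun ε => eulerOp α (u ε)) {r : ℝ} (hr : 0 < r) {K : Set (Space d)}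
    (hK : IsCompact K) (hKΩ : K ⊆ Ω) (m : ℕ) :
    IsBigOOn K (fun ε => dilateDefect α r (u ε)) m := by
  obtain ⟨s, rfl⟩ : ∃ s, Real.exp s = r := ⟨Real.log r, Real.exp_log hr⟩
  -- The unordered interval covers `r < 1`, where `s` is negative.
  obtain ⟨K', hK', hK'Ω, hKK'⟩ :=
    exists_isCompact_dilates hΩ hK hKΩ (isCompact_uIcc (a := 0) (b := s))
  obtain ⟨C, η, hη, H⟩ := h.2 K' hK' hK'Ω [] m
  have hF : IsBigOOn K (fun ε x => ((Real.exp (-(α * s)) : ℝ) : ℂ) * u ε (Real.exp s • x) - u ε x)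
      (m : ℤ) := by
    refine ⟨Real.exp (|α| * |s|) * C * |s|, η, hη, fun ε hε x hx => ?_⟩
    have hd : ∀ t ∈ Set.uIcc 0 s, HasDerivWithinAt
        (fun t : ℝ => ((Real.exp (-(α * t)) : ℝ) : ℂ) * u ε (Real.exp t • x))
        (((Real.exp (-(α * t)) : ℝ) : ℂ) * eulerOp α (u ε) (Real.exp t • x)) (Set.uIcc 0 s) t :=
      fun t ht => (hasDerivAt_exp_mul_dilate (hu ε) α t
        (hK'Ω (hKK' x hx t ht))).hasDerivWithinAt
    have hb : ∀ t ∈ Set.uIcc 0 s,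
        ‖((Real.exp (-(α * t)) : ℝ) : ℂ) * eulerOp α (u ε) (Real.exp t • x)‖ ≤
          Real.exp (|α| * |s|) * (C * (ε : ℝ) ^ (m : ℤ)) := fun t ht =>
      norm_exp_mul_le (by simpa using Set.abs_sub_left_of_mem_uIcc ht) _
        (H ε hε _ (hKK' x hx t ht))
    have := (convex_uIcc 0 s).norm_image_sub_le_of_norm_hasDerivWithin_le hd hb
      Set.left_mem_uIcc Set.right_mem_uIcc
    simp only [mul_zero, neg_zero, Real.exp_zero, Complex.ofReal_one, one_mul, one_smul,
      sub_zero, Real.norm_eq_abs] at this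
    refine this.trans_eq ?_
    ring
  refine (hF.smul ((Real.exp (α * s) : ℝ) : ℂ)).congr fun ε x _ => ?_
  rw [dilateDefect_exp]; rfl

/-- Induction on the word of derivatives; `α` must vary because each derivative lowers the degree by
one. -/
theorem isNegligible_dilateDefect (hΩ : IsConic Ω) {α : ℝ} (hu : IsSmoothNet Ω u)
    (h : IsNegligible Ω fun ε => eulerOp α (u ε)) {r : ℝ} (hr : 0 < r) :
    IsNegligible Ω fun ε => dilateDefect α r (u ε) := by
  refine ⟨fun ε => contDiffOn_dilateDefect (hu ε) (hΩ r hr) α, fun K hK hKΩ w => ?_⟩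
  induction w generalizing u α with
  | nil => exact fun m => isBigOOn_dilateDefect hΩ hu h hr hK hKΩ m
  | cons i w ih =>
    intro m
    have hi := ih (u := fun ε => partialDeriv i (u ε))
      (fun ε => contDiffOn_partialDeriv (hu ε) i) (isNegligible_eulerOp_partialDeriv hu h i) m
    refine (hi.smul (r : ℂ)).congr fun ε x hx => ?_
    have := iterPartial_congr w (partialDeriv_dilateDefect (hu ε) hr (hΩ r hr) α i) (hKΩ hx)
    rw [iterPartial_smul] at this
    exact this.symm

/-! ### From homogeneity to the Euler equation -/

/-- A one-sided Landau inequality. -/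
theorem mul_norm_deriv_le {g g' g'' : ℝ → ℂ} {a τ A M : ℝ} {c : ℂ} (hτ : 0 ≤ τ) (hM : 0 ≤ M)
    (hg : ∀ t ∈ Set.Icc a (a + τ), HasDerivAt g (g' t) t)
    (hg' : ∀ t ∈ Set.Icc a (a + τ), HasDerivAt g' (g'' t) t)
    (hA : ∀ t ∈ Set.Icc a (a + τ), ‖g t - c‖ ≤ A)
    (hgM : ∀ t ∈ Set.Icc a (a + τ), ‖g'' t‖ ≤ M) : τ * ‖g' a‖ ≤ 2 * A + M * τ * τ := by
  have ha : a ∈ Set.Icc a (a + τ) := ⟨le_rfl, by linarith⟩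
  have hb : a + τ ∈ Set.Icc a (a + τ) := ⟨by linarith, le_rfl⟩
  have h1 : ∀ t ∈ Set.Icc a (a + τ), ‖g' t - g' a‖ ≤ M * τ := by
    intro t ht
    refine ((convex_Icc a (a + τ)).norm_image_sub_le_of_norm_hasDerivWithin_le
      (fun t ht => (hg' t ht).hasDerivWithinAt) hgM ha ht).trans
        (mul_le_mul_of_nonneg_left ?_ hM)
    rw [Real.norm_eq_abs, abs_of_nonneg (by linarith [ht.1])]
    linarith [ht.2]
  -- Subtracting the linear part leaves a function whose derivative `g' t - g' a` is at most `M *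
  -- τ`, so its increment over length `τ` is at most `M * τ * τ`.
  have h2 := (convex_Icc a (a + τ)).norm_image_sub_le_of_norm_hasDerivWithin_le
    (f := fun t => g t - t * g' a) (f' := fun t => g' t - g' a)
    (fun t ht => by
      have := (hg t ht).sub ((hasDerivAt_id t).ofReal_comp.mul_const (g' a))
      rw [Complex.ofReal_one, one_mul] at this
      exact this.hasDerivWithinAt) h1 ha hb
  have h3 : (τ : ℂ) * g' a = (g (a + τ) - c) - (g a - c) -
      (g (a + τ) - ((a + τ : ℝ) : ℂ) * g' a - (g a - a * g' a)) := by
    push_cast; ring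
  have h4 : ‖(τ : ℂ) * g' a‖ = τ * ‖g' a‖ := by
    rw [norm_mul, Complex.norm_real, Real.norm_of_nonneg hτ]
  rw [add_sub_cancel_left, Real.norm_of_nonneg hτ] at h2
  rw [← h4, h3]
  refine (norm_sub_le _ _).trans (add_le_add ?_ h2)
  refine (norm_sub_le _ _).trans ?_
  linarith [hA _ ha, hA _ hb]

/-- By Baire's theorem, pointwise growth estimates along a continuous path of nets are uniform
on some interval. -/
theorem exists_uniform_isBigOOn {F : ℝ → Net d} {K : Set (Space d)} {m : ℤ}
    (hc : ∀ ε, ∀ x ∈ K, Continuous fun s => F s ε x) (hF : ∀ s, IsBigOOn K (F s) m) :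
    ∃ a δ C η : ℝ, 0 < δ ∧ 0 < η ∧ Set.Icc a (a + δ) ⊆ Set.Icc 0 1 ∧
      ∀ s ∈ Set.Icc a (a + δ), ∀ ε : Param, (ε : ℝ) < η → ∀ x ∈ K,
        ‖F s ε x‖ ≤ C * (ε : ℝ) ^ m := by
  -- One integer `k` bounds both the constant and the inverse threshold, so countably many closed
  -- sets cover the line.
  set A : ℕ → Set ℝ := fun k => {s | ∀ ε : Param, (ε : ℝ) < 1 / ((k : ℝ) + 1) → ∀ x ∈ K,
    ‖F s ε x‖ ≤ k * (ε : ℝ) ^ m} with hA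
  have hAc : ∀ k, IsClosed (A k) := by
    intro k
    simp only [hA, Set.ofPred_forall]
    exact isClosed_iInter fun ε => isClosed_iInter fun _ => isClosed_iInter fun x =>
      isClosed_iInter fun hx => isClosed_le (hc ε x hx).norm continuous_const
  have hAU : ∀ s, ∃ k, s ∈ A k := by
    intro s
    obtain ⟨C, η, hη, H⟩ := hF s
    obtain ⟨k₁, hk₁⟩ := exists_nat_ge C
    obtain ⟨k₂, hk₂⟩ := exists_nat_one_div_lt hη
    refine ⟨max k₁ k₂, fun ε hε x hx => (H ε (hε.trans_le ?_) x hx).trans ?_⟩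
    · refine le_trans (one_div_le_one_div_of_le (by positivity) ?_) hk₂.le
      have : (k₂ : ℝ) ≤ (max k₁ k₂ : ℕ) := by exact_mod_cast le_max_right _ _
      linarith
    · refine mul_le_mul_of_nonneg_right (hk₁.trans ?_) (zpow_nonneg ε.2.1.le m)
      exact_mod_cast le_max_left _ _
  -- Baire is applied in the open interval so that a whole neighbourhood of the point found lies
  -- inside `[0, 1]`.
  have : BaireSpace (Set.Ioo (0 : ℝ) 1) := isOpen_Ioo.baireSpace
  have : Nonempty (Set.Ioo (0 : ℝ) 1) := ⟨⟨1 / 2, by norm_num, by norm_num⟩⟩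
  obtain ⟨k, s, hs⟩ := nonempty_interior_of_iUnion_of_closed
    (f := fun k => ((↑) : Set.Ioo (0 : ℝ) 1 → ℝ) ⁻¹' A k)
    (fun k => (hAc k).preimage continuous_subtype_val)
    (Set.eq_univ_of_forall fun s => Set.mem_iUnion.2 (hAU s))
  have hn : ((↑) : Set.Ioo (0 : ℝ) 1 → ℝ) '' ((↑) ⁻¹' A k) ∈ nhds (s : ℝ) :=
    isOpen_Ioo.isOpenMap_subtype_val.image_mem_nhds (mem_interior_iff_mem_nhds.1 hs)
  rw [Subtype.image_preimage_coe] at hn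
  obtain ⟨δ, hδ, hsub⟩ := Metric.nhds_basis_closedBall.mem_iff.1 hn
  have hI : Set.Icc (s : ℝ) (s + δ) ⊆ Set.Ioo 0 1 ∩ A k :=
    (Set.Icc_subset_Icc_left (by linarith)).trans (Real.closedBall_eq_Icc ▸ hsub)
  exact ⟨s, δ, k, 1 / ((k : ℝ) + 1), hδ, by positivity,
    fun t ht => Set.Ioo_subset_Icc_self (hI ht).1, fun t ht => (hI ht).2⟩

theorem isBigOOn_eulerOp (hΩ : IsConic Ω) {α : ℝ} (hu : IsModerate Ω u)
    (h : ∀ r : ℝ, 0 < r → IsNegligible Ω fun ε => dilateDefect α r (u ε)) {K : Set (Space d)}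
    (hK : IsCompact K) (hKΩ : K ⊆ Ω) (m : ℕ) :
    IsBigOOn K (fun ε => eulerOp α (u ε)) m := by
  obtain ⟨K', hK', hK'Ω, hKK'⟩ :=
    exists_isCompact_dilates hΩ hK hKΩ (isCompact_Icc (a := (0 : ℝ)) (b := 1))
  obtain ⟨N, C₂, η₂, hη₂, H₂⟩ := ((hu.eulerOp α).eulerOp α).2 K' hK' hK'Ω []
  obtain ⟨a, δ, C₁, η₁, hδ, hη₁, hsub, H₁⟩ := exists_uniform_isBigOOn (K := K)
    (F := fun s ε x => ((Real.exp (-(α * s)) : ℝ) : ℂ) * u ε (Real.exp s • x) - u ε x)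
    -- With step `τ ~ ε^(N+m)`, Landau's inequality bounds `‖G'(a)‖` by `2A/τ + Mτ`. Since `M ~
    -- ε^(-N)`, the second term is of order `ε^m`; the first is too once `A ~ ε^(N+m+m)`.
    (m := ((N + m + m : ℕ) : ℤ))
    (fun ε x hx => Continuous.sub (continuous_iff_continuousAt.2 fun s =>
      (hasDerivAt_exp_mul_dilate (hu.1 ε) α s
        (hΩ _ (Real.exp_pos s) x (hKΩ hx))).continuousAt) continuous_const)
    (fun s => by
      refine (((h _ (Real.exp_pos s)).2 K hK hKΩ [] _).smul
        ((Real.exp (-(α * s)) : ℝ) : ℂ)).congr fun ε x _ => ?_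
      change ((Real.exp (-(α * s)) : ℝ) : ℂ) * dilateDefect α (Real.exp s) (u ε) x = _
      rw [dilateDefect_exp, ← mul_assoc, ← Complex.ofReal_mul, ← Real.exp_add]
      simp)
  have hG : IsBigOOn K
      (fun ε x => ((Real.exp (-(α * a)) : ℝ) : ℂ) * eulerOp α (u ε) (Real.exp a • x)) (m : ℤ) := by
    refine ⟨2 * C₁ / δ + Real.exp (|α| * 1) * C₂ * δ, min η₁ η₂, lt_min hη₁ hη₂,
      fun ε hε x hx => ?_⟩
    have he : (0 : ℝ) < ε := ε.2.1
    -- The factor `δ` keeps the step inside the Baire interval, since `ε ≤ 1`.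
    set τ : ℝ := δ * (ε : ℝ) ^ (N + m) with hτ
    have hτ0 : 0 < τ := by positivity
    have hτδ : τ ≤ δ := mul_le_of_le_one_right hδ.le (pow_le_one₀ he.le ε.2.2)
    have hI : Set.Icc a (a + τ) ⊆ Set.Icc a (a + δ) := Set.Icc_subset_Icc_right (by linarith)
    have hM : ∀ t ∈ Set.Icc a (a + τ), ‖((Real.exp (-(α * t)) : ℝ) : ℂ) *
        eulerOp α (eulerOp α (u ε)) (Real.exp t • x)‖ ≤
          Real.exp (|α| * 1) * (C₂ * (ε : ℝ) ^ (-(N : ℤ))) := by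
      intro t ht
      have ht' := hsub (hI ht)
      exact norm_exp_mul_le (abs_le.2 ⟨by linarith [ht'.1], ht'.2⟩) _
        (H₂ ε (hε.trans_le (min_le_right _ _)) _ (hKK' x hx t ht'))
    have hΩx : ∀ t, Real.exp t • x ∈ Ω := fun t => hΩ _ (Real.exp_pos t) x (hKΩ hx)
    have key := mul_norm_deriv_le hτ0.le
      ((norm_nonneg _).trans (hM a ⟨le_rfl, by linarith⟩))
      (fun t _ => hasDerivAt_exp_mul_dilate (hu.1 ε) α t (hΩx t))
      (fun t _ => hasDerivAt_exp_mul_dilate ((hu.eulerOp α).1 ε) α t (hΩx t))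
      (fun t ht => H₁ t (hI ht) ε (hε.trans_le (min_le_left _ _)) x hx) hM
    refine le_of_mul_le_mul_left (key.trans_eq ?_) hτ0
    have hN : (ε : ℝ) ^ (-(N : ℤ)) * (ε : ℝ) ^ (N + m) = (ε : ℝ) ^ m := by
      rw [zpow_neg, zpow_natCast, pow_add, inv_mul_cancel_left₀ (pow_ne_zero _ he.ne')]
    rw [zpow_natCast, zpow_natCast, pow_add _ (N + m) m]
    calc _ = 2 * (C₁ * ((ε : ℝ) ^ (N + m) * (ε : ℝ) ^ m)) + Real.exp (|α| * 1) * C₂ * δ *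
          ((ε : ℝ) ^ (-(N : ℤ)) * (ε : ℝ) ^ (N + m)) * τ := by rw [hτ]; ring
      _ = _ := by rw [hN, hτ]; field_simp
  -- `hG` concerns the point `e^a x`. The defect of `E u` is `E` of the defect of `u`, hence
  -- negligible; subtracting `e^(-αa)` times it from the quantity in `hG` leaves `E u` at `x`.
  have hD : IsBigOOn K (fun ε => dilateDefect α (Real.exp a) (eulerOp α (u ε))) (m : ℤ) :=
    (((h _ (Real.exp_pos a)).eulerOp α).2 K hK hKΩ [] m).congr fun ε =>
      (eulerOp_dilateDefect (hu.1 ε) (hΩ _ (Real.exp_pos a)) α).mono hKΩ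
  refine (hG.add (hD.smul (-((Real.exp (-(α * a)) : ℝ) : ℂ)))).congr fun ε x _ => ?_
  simp only [Pi.add_apply, Pi.smul_apply, smul_eq_mul]
  rw [dilateDefect_exp, neg_mul, ← mul_assoc, ← Complex.ofReal_mul, ← Real.exp_add]
  simp

/-- The same induction: homogeneity of degree `α` passes to each partial derivative with degree `α -
1`. -/
theorem isNegligible_eulerOp (hΩ : IsConic Ω) {α : ℝ} (hu : IsModerate Ω u)
    (h : ∀ r : ℝ, 0 < r → IsNegligible Ω fun ε => dilateDefect α r (u ε)) :
    IsNegligible Ω fun ε => eulerOp α (u ε) := by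
  refine ⟨(hu.eulerOp α).1, fun K hK hKΩ w => ?_⟩
  induction w generalizing u α with
  | nil => exact fun m => isBigOOn_eulerOp hΩ hu h hK hKΩ m
  | cons i w ih =>
    intro m
    exact (ih (hu.partialDeriv i) (fun r hr => isNegligible_dilateDefect_partialDeriv hr
      (hΩ r hr) hu.1 (h r hr) i) m).congr fun ε =>
        (iterPartial_congr w (partialDeriv_eulerOp (hu.1 ε) α i)).symm.mono hKΩ

end Nets

/-! ### Passage to the quotient algebra -/

set_option synthInstance.maxHeartbeats 200000 in
theorem satisfiesEuler_mk {u : Net d} (hu : IsModerate Ω u) (α : ℝ) :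
    SatisfiesEuler α (mk u hu) ↔ IsNegligible Ω fun ε => eulerOp α (u ε) := by
  let X : Fin d → Moderate Ω := fun i => ⟨fun _ x => ((x i : ℝ) : ℂ),
    isModerate_of_smooth (contDiff_coord i).contDiffOn⟩
  let P : Fin d → Moderate Ω := fun i => ⟨fun ε => partialDeriv i (u ε), hu.partialDeriv i⟩
  have h1 : ∑ i : Fin d, coord i * pderiv i (mk u hu) =
      Ideal.Quotient.mk (Negligible Ω) (∑ i, X i * P i) := by
    rw [map_sum (Ideal.Quotient.mk (Negligible Ω))]
    exact Finset.sum_congr rfl fun i _ => (map_mul _ _ _).symm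
  have h2 : (α : ℂ) • mk u hu = Ideal.Quotient.mk (Negligible Ω) ((α : ℂ) • ⟨u, hu⟩) := rfl
  have h3 : ((∑ i, X i * P i - (α : ℂ) • ⟨u, hu⟩ : Moderate Ω) : Net d) =
      fun ε => eulerOp α (u ε) := by
    funext ε x
    simp [X, P, eulerOp, Finset.sum_apply]
  rw [SatisfiesEuler, h1, h2, Ideal.Quotient.eq, ← h3]
  rfl

theorem isHomogeneous_mk (hΩ : IsConic Ω) {u : Net d} (hu : IsModerate Ω u) (α : ℝ) :
    IsHomogeneous hΩ α (mk u hu) ↔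
      ∀ r : ℝ, 0 < r → IsNegligible Ω fun ε => dilateDefect α r (u ε) :=
  -- Scalar multiplication in the quotient acts on representatives by definition, so both sides are
  -- classes of explicit nets whose difference is the defect.
  forall₂_congr fun r hr => mk_eq_mk (isModerate_dilate (hΩ r hr) hu)
    ((Moderate Ω).smul_mem hu ((r ^ α : ℝ) : ℂ))

/-- Euler's theorem for generalized functions on a conic open set. -/
theorem satisfiesEuler_iff_isHomogeneous (hΩ : IsConic Ω) (α : ℝ) (u : GenFun Ω) :
    SatisfiesEuler α u ↔ IsHomogeneous hΩ α u := by
  obtain ⟨⟨u, hu⟩, rfl⟩ := Ideal.Quotient.mk_surjective u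
  have hu : IsModerate Ω u := hu
  change SatisfiesEuler α (mk u hu) ↔ IsHomogeneous hΩ α (mk u hu)
  rw [satisfiesEuler_mk, isHomogeneous_mk]
  exact ⟨fun h r hr => isNegligible_dilateDefect hΩ hu.1 h hr, isNegligible_eulerOp hΩ hu⟩

end Colombeau

theorem mainTheorem4 (d : ℕ) (hd : 1 ≤ d) (α : ℝ) :
    (∀ u : Colombeau.GenFun (Colombeau.whole d),
      Colombeau.SatisfiesEuler α u ↔
        Colombeau.IsHomogeneous (Colombeau.isConic_whole d) α u) ∧
    (∀ u : Colombeau.GenFun (Colombeau.punctured d),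
      Colombeau.SatisfiesEuler α u ↔
        Colombeau.IsHomogeneous (Colombeau.isConic_punctured d) α u) := by
  exact ⟨Colombeau.satisfiesEuler_iff_isHomogeneous _ α,
    Colombeau.satisfiesEuler_iff_isHomogeneous _ α⟩
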